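/- Let $R$ be a commutative Noetherian ring with identity, $M\neq 0$ a finitely generated $R$-module and $N\neq 0$ an arbitrary (not necessarily finitely generated) $R$-module. For a complex $X$ of $R$-modules put $\sup X=\sup\{i\in\mathbb Z\mid X_i\ne 0\}$, $\inf X=\inf\{i\in\mathbb Z\mid X_i\ne 0\}$, $\operatorname{hsup}X=\sup\{i\in\mathbb Z\mid \operatorname{H}_i(X)\ne 0\}$ and $\operatorname{hinf}X=\inf\{i\in\mathbb Z\mid \operatorname{H}_i(X)\ne 0\}$. A quasi-projective resolution of $N$ is a complex $P$ of projective $R$-modules (homologically indexed) with $\inf P>-\infty$ such that there are integers $a_i\ge 0$ $(i\in\mathbb Z)$, not all zero, with $\operatorname{H}_i(P)\cong N^{\oplus a_i}$ for all $i$; it is finite if $\sup P<\infty$. The quasi-projective dimension $\operatorname{qpd}_RN$ of $N\ne0$ is the infimum of $\sup P-\operatorname{hsup}P$ over all finite quasi-projective resolutions $P$ of $N$ ($\infty$ if there is none). With $(-)^*=\operatorname{Hom}_R(-,R)$, a finitely generated $R$-module $G$ is totally reflexive if the natural map $G\to G^{**}$ is an isomorphism and $\operatorname{Ext}^i_R(G,R)=0=\operatorname{Ext}^i_R(G^*,R)$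 for all $i>0$. The G-dimension $\operatorname{G-dim}_RM$ is the infimum of the integers $n\ge 0$ for which there is an exact sequence $0\to G_n\to\cdots\to G_0\to M\to 0$ with every $G_i$ totally reflexive ($\infty$ if there is none). **Theorem.** Suppose $\operatorname{qpd}_RN<\infty$, let $P$ be a finite quasi-projective resolution of $N$, and let $n>0$ be an integer with $\operatorname{G-dim}_RM<n$. 1. If $\operatorname{Tor}^R_i(M,N)=0$ for all $n\le i\le n+\operatorname{hsup}P-\operatorname{hinf}P$, then $\operatorname{Tor}^R_i(M,N)=0$ for all $i>\operatorname{G-dim}_RM$. 2. If $\operatorname{Ext}_R^i(M,N)=0$ for all $n\le i\le n+\operatorname{hsup}P-\operatorname{hinf}P$, then $\operatorname{Ext}_R^i(M,N)=0$ for all $i>\operatorname{G-dim}_RM$. -/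

import Mathlib

open CategoryTheory

universe u

namespace QuasiProj

section Complexes

variable {R : Type u} [CommRing R]

/-- `sup X = sup {i ∈ ℤ | Xᵢ ≠ 0}`, an extended real number (`⊥` for the zero complex). -/
noncomputable def cxSup (X : ChainComplex (ModuleCat.{u} R) ℤ) : EReal :=
  sSup {e : EReal | ∃ i : ℤ, Nontrivial (X.X i) ∧ e = ((i : ℝ) : EReal)}

/-- `inf X = inf {i ∈ ℤ | Xᵢ ≠ 0}`, an extended real number (`⊤` for the zero complex). -/
noncomputable def cxInf (X : ChainComplex (ModuleCat.{u} R) ℤ) : EReal :=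
  sInf {e : EReal | ∃ i : ℤ, Nontrivial (X.X i) ∧ e = ((i : ℝ) : EReal)}

/-- `hsup X = sup {i ∈ ℤ | Hᵢ(X) ≠ 0}`. -/
noncomputable def hsup (X : ChainComplex (ModuleCat.{u} R) ℤ) : EReal :=
  sSup {e : EReal | ∃ i : ℤ, Nontrivial (X.homology i) ∧ e = ((i : ℝ) : EReal)}

/-- `hinf X = inf {i ∈ ℤ | Hᵢ(X) ≠ 0}`. -/
noncomputable def hinf (X : ChainComplex (ModuleCat.{u} R) ℤ) : EReal :=
  sInf {e : EReal | ∃ i : ℤ, Nontrivial (X.homology i) ∧ e = ((i : ℝ) : EReal)}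

end Complexes

section QuasiProjective

variable (R : Type u) [CommRing R] (N : Type u) [AddCommGroup N] [Module R N]

/-- A quasi-projective resolution of `N`: a bounded below complex of projective modules each of
whose homology modules is a finite direct sum of copies of `N`, the numbers of copies not being
all zero. -/
structure IsQuasiProjectiveResolution (P : ChainComplex (ModuleCat.{u} R) ℤ) : Prop where
  bounded_below : ⊥ < cxInf P
  projective : ∀ i : ℤ, Module.Projective R (P.X i)
  homology_eq : ∃ a : ℤ → ℕ, (∃ i, a i ≠ 0) ∧
    ∀ i : ℤ, Nonempty (P.homology i ≃ₗ[R] (Fin (a i) → N))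

/-- A finite quasi-projective resolution: one that is also bounded above. -/
structure IsFiniteQuasiProjectiveResolution (P : ChainComplex (ModuleCat.{u} R) ℤ) : Prop
    extends IsQuasiProjectiveResolution R N P where
  bounded_above : cxSup P < ⊤

open scoped Classical in
/-- The quasi-projective dimension of `N`. It is `⊥` when `N = 0` and `⊤` when `N ≠ 0` has no finite
quasi-projective resolution. -/
noncomputable def qpd : EReal :=
  if Subsingleton N then ⊥ else
    sInf {e : EReal | ∃ P : ChainComplex (ModuleCat.{u} R) ℤ,
      IsFiniteQuasiProjectiveResolution R N P ∧ e = cxSup P - hsup P}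

end QuasiProjective

section TorExt

variable (R : Type u) [CommRing R] (M N : Type u) [AddCommGroup M] [Module R M]
  [AddCommGroup N] [Module R N]

/-- `Torᵢ(M, N) = 0`, where `Torᵢ(M, N) = Hᵢ(F ⊗ N)` for a projective resolution `F` of `M`. -/
def TorVanishes (i : ℕ) : Prop :=
  Subsingleton (((Tor' (ModuleCat.{u} R) i).obj (ModuleCat.of R M)).obj (ModuleCat.of R N))

/-- `Extⁱ(M, N) = 0`. -/
def ExtVanishes (i : ℕ) : Prop :=
  Subsingleton (Abelian.Ext (ModuleCat.of R M) (ModuleCat.of R N) i)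

end TorExt

section Gorenstein

variable (R : Type u) [CommRing R] (M : Type u) [AddCommGroup M] [Module R M]

/-- Totally reflexive modules. -/
structure IsTotallyReflexive : Prop where
  finite : Module.Finite R M
  reflexive : Module.IsReflexive R M
  ext_self : ∀ i : ℕ, 0 < i → ExtVanishes R M R i
  ext_dual : ∀ i : ℕ, 0 < i → ExtVanishes R (Module.Dual R M) R i

/-- There is an exact sequence `0 → Gₙ → ⋯ → G₀ → M → 0` with every `Gᵢ` totally reflexive. It is
written as an infinite sequence that is zero beyond degree `n`. -/
def HasTotallyReflexiveResolution (n : ℕ) : Prop :=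
  ∃ (G : ℕ → ModuleCat.{u} R) (d : ∀ i, G (i + 1) →ₗ[R] G i) (ε : G 0 →ₗ[R] M),
    (∀ i, i ≤ n → IsTotallyReflexive R (G i)) ∧
    (∀ i, n < i → Subsingleton (G i)) ∧
    Function.Surjective ε ∧
    Function.Exact (d 0) ε ∧
    ∀ i, Function.Exact (d (i + 1)) (d i)

/-- The Gorenstein dimension of `M` (`⊤` if there is no resolution as above). -/
noncomputable def gdim : ℕ∞ :=
  sInf {e : ℕ∞ | ∃ n : ℕ, HasTotallyReflexiveResolution R M n ∧ e = (n : ℕ∞)}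

end Gorenstein

end QuasiProj

/-! Call `W` acyclic if `Extⁱ(G, W) = 0` for all `i > 0` and all totally reflexive `G`. Projective
modules are acyclic (`extVanishes_projective_right`), as are injective ones. Acyclicity passes to
the third term of a short exact sequence from the other two. For the left term
(`HasSES.isTRAcyclic₁`), this uses that `G` embeds in a projective module with totally reflexive
cokernel. Shifting along a resolution of `M` gives `Extⁱ(M, W) = 0` for `i > G-dim M`.

Take a bounded complex of acyclic modules whose homology modules are finite powers of `L`, the
extreme nonzero ones in degrees `t` and `t + w`. Exactness outside this range makes the cycles in
degree `t` and the boundaries in degree `t + w` acyclic. Climbing from `t` to `t + w`, a run of `w +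
1` consecutive vanishing `Ext(M, L)` forces the next one; descending, it forces the previous one, as
long as degrees stay above `G-dim M`. Hence `extVanishes_of_window`.

The `Ext` statement is the case of `P` itself, with `L = N`. For `Tor`, write `X⁺` for the character
module: `Torᵢ(M, N) = 0` iff `Extⁱ(M, N⁺) = 0` for `i > 0`, and `P⁺` is a bounded complex of
injectives whose homology consists of finite powers of `N⁺`. -/

namespace QuasiProj

/-! ### Short exact sequences and character modules. -/

section Ses

variable (R : Type u) [CommRing R]

/-- There is a short exact sequence `0 → A → B → C → 0`. -/
def HasSES (A B C : Type u) [AddCommGroup A] [Module R A] [AddCommGroup B] [Module R B]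
    [AddCommGroup C] [Module R C] : Prop :=
  ∃ (f : A →ₗ[R] B) (g : B →ₗ[R] C),
    Function.Injective f ∧ Function.Exact f g ∧ Function.Surjective g

variable {R}
variable {A B C : Type u} [AddCommGroup A] [Module R A] [AddCommGroup B] [Module R B]
    [AddCommGroup C] [Module R C]

lemma HasSES.exists_shortExact (h : HasSES R A B C) :
    ∃ (f : ModuleCat.of R A ⟶ ModuleCat.of R B) (g : ModuleCat.of R B ⟶ ModuleCat.of R C)
      (w : f ≫ g = 0), (ShortComplex.mk f g w).ShortExact := by
  obtain ⟨f, g, hf, hfg, hg⟩ := h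
  exact ⟨ModuleCat.ofHom f, ModuleCat.ofHom g, by ext x; exact hfg.apply_apply_eq_zero x,
    ModuleCat.shortComplex_shortExact _ hfg hf hg⟩

lemma hasSES_ker (f : A →ₗ[R] B) (hf : Function.Surjective f) : HasSES R (LinearMap.ker f) A B :=
  ⟨(LinearMap.ker f).subtype, f, Subtype.val_injective, LinearMap.exact_subtype_ker_map f, hf⟩

lemma hasSES_quotient (S : Submodule R A) : HasSES R S A (A ⧸ S) :=
  ⟨S.subtype, S.mkQ, Subtype.val_injective, LinearMap.exact_subtype_mkQ S, S.mkQ_surjective⟩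

lemma HasSES.congr_left (h : HasSES R A B C) {A' : Type u} [AddCommGroup A'] [Module R A']
    (e : A' ≃ₗ[R] A) : HasSES R A' B C := by
  obtain ⟨f, g, hf, hfg, hg⟩ := h
  refine ⟨f ∘ₗ e.toLinearMap, g, hf.comp e.injective, fun x ↦ (hfg x).trans ?_, hg⟩
  exact ⟨fun ⟨y, hy⟩ ↦ ⟨e.symm y, by simpa using hy⟩, fun ⟨y, hy⟩ ↦ ⟨e y, hy⟩⟩

lemma HasSES.congr_right (h : HasSES R A B C) {C' : Type u} [AddCommGroup C'] [Module R C']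
    (e : C ≃ₗ[R] C') : HasSES R A B C' := by
  obtain ⟨f, g, hf, hfg, hg⟩ := h
  exact ⟨f, e.toLinearMap ∘ₗ g, hf, fun x ↦ by simp [hfg x], e.surjective.comp hg⟩

lemma exact_characterModule_dual {f : A →ₗ[R] B} {g : B →ₗ[R] C} (hfg : Function.Exact f g) :
    Function.Exact (CharacterModule.dual g) (CharacterModule.dual f) := by
  refine fun φ ↦ ⟨fun hφ ↦ ?_, ?_⟩
  · have hφ' : ∀ b, g b = 0 → φ b = 0 := by
      intro b hb
      obtain ⟨a, rfl⟩ := (hfg b).1 hb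
      exact DFunLike.congr_fun hφ a
    obtain ⟨s, hs⟩ := g.surjective_rangeRestrict.hasRightInverse
    have hs' : ∀ c, g (s c) = c := fun c ↦ congr_arg Subtype.val (hs c)
    obtain ⟨ψ, hψ⟩ := CharacterModule.dual_surjective_of_injective (LinearMap.range g).subtype
      Subtype.val_injective (AddMonoidHom.mk' (fun c ↦ φ (s c)) fun x y ↦ by
        rw [← map_add, ← sub_eq_zero, ← map_sub]
        exact hφ' _ (by simp [hs']))
    refine ⟨ψ, ?_⟩
    ext b
    refine (DFunLike.congr_fun hψ (g.rangeRestrict b)).trans ?_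
    change φ (s (g.rangeRestrict b)) = φ b
    rw [← sub_eq_zero, ← map_sub]
    exact hφ' _ (by simp [hs'])
  · rintro ⟨c, rfl⟩
    ext a
    change c (g (f a)) = 0
    rw [hfg.apply_apply_eq_zero, map_zero]

/-- Exactness is reflected because characters separate points: a character of `B / im f`, pulled
back to `B`, factors through `g`, so it kills the class of every element of `ker g`. -/
lemma exact_characterModule_dual_iff {f : A →ₗ[R] B} {g : B →ₗ[R] C} :
    Function.Exact (CharacterModule.dual g) (CharacterModule.dual f) ↔ Function.Exact f g := by
  refine ⟨fun h b ↦ ⟨fun hb ↦ ?_, ?_⟩, exact_characterModule_dual⟩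
  · suffices hb' : (LinearMap.range f).mkQ b = 0 by simpa using hb'
    refine CharacterModule.eq_zero_of_character_apply fun c ↦ ?_
    obtain ⟨c', hc'⟩ := (h (CharacterModule.dual (LinearMap.range f).mkQ c)).1 <| by
      rw [← LinearMap.comp_apply, ← CharacterModule.dual_comp, LinearMap.range_mkQ_comp,
        CharacterModule.dual_zero, LinearMap.zero_apply]
    refine (DFunLike.congr_fun hc' b).symm.trans ?_
    change c' (g b) = 0
    rw [hb, map_zero]
  · rintro ⟨a, rfl⟩
    refine CharacterModule.eq_zero_of_character_apply fun c ↦ ?_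
    exact DFunLike.congr_fun (h.apply_apply_eq_zero c) a

lemma HasSES.characterModule (h : HasSES R A B C) :
    HasSES R (CharacterModule C) (CharacterModule B) (CharacterModule A) := by
  obtain ⟨f, g, hf, hfg, hg⟩ := h
  exact ⟨CharacterModule.dual g, CharacterModule.dual f,
    CharacterModule.dual_injective_of_surjective g hg, exact_characterModule_dual hfg,
    CharacterModule.dual_surjective_of_injective f hf⟩

end Ses

/-! ### Vanishing of `Ext` along retracts, short exact sequences and finite powers. -/

section ExtVanishing

variable {R : Type u} [CommRing R]
variable {A B C M N : Type u} [AddCommGroup A] [Module R A] [AddCommGroup B] [Module R B]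
    [AddCommGroup C] [Module R C] [AddCommGroup M] [Module R M] [AddCommGroup N] [Module R N]

open Abelian

lemma ExtVanishes.of_retract_right {i : ℕ} (h : ExtVanishes R M B i) (f : A →ₗ[R] B)
    (g : B →ₗ[R] A) (hgf : g ∘ₗ f = LinearMap.id) : ExtVanishes R M A i := by
  refine subsingleton_of_forall_eq 0 fun x ↦ ?_
  have hid : ModuleCat.ofHom f ≫ ModuleCat.ofHom g = 𝟙 _ := by
    rw [← ModuleCat.ofHom_comp, hgf]; rfl
  have hx : (x.comp (Ext.mk₀ (ModuleCat.ofHom f)) (add_zero i)).comp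
      (Ext.mk₀ (ModuleCat.ofHom g)) (add_zero i) = x := by
    rw [Ext.comp_assoc_of_third_deg_zero, Ext.mk₀_comp_mk₀, hid, Ext.comp_mk₀_id]
  rw [← hx, h.elim (x.comp _ _) 0, Ext.zero_comp]

lemma ExtVanishes.of_retract_left {i : ℕ} (h : ExtVanishes R B M i) (f : A →ₗ[R] B)
    (g : B →ₗ[R] A) (hgf : g ∘ₗ f = LinearMap.id) : ExtVanishes R A M i := by
  refine subsingleton_of_forall_eq 0 fun x ↦ ?_
  have hid : ModuleCat.ofHom f ≫ ModuleCat.ofHom g = 𝟙 _ := by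
    rw [← ModuleCat.ofHom_comp, hgf]; rfl
  have hx : (Ext.mk₀ (ModuleCat.ofHom f)).comp
      ((Ext.mk₀ (ModuleCat.ofHom g)).comp x (zero_add i)) (zero_add i) = x := by
    rw [Ext.mk₀_comp_mk₀_assoc, hid, Ext.mk₀_id_comp]
  rw [← hx, h.elim ((Ext.mk₀ (ModuleCat.ofHom g)).comp x _) 0, Ext.comp_zero]

lemma ExtVanishes.congr_right {i : ℕ} (h : ExtVanishes R M B i) (e : A ≃ₗ[R] B) :
    ExtVanishes R M A i :=
  h.of_retract_right e.toLinearMap e.symm.toLinearMap (by ext; simp)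

lemma ExtVanishes.congr_left {i : ℕ} (h : ExtVanishes R B M i) (e : A ≃ₗ[R] B) :
    ExtVanishes R A M i :=
  h.of_retract_left e.toLinearMap e.symm.toLinearMap (by ext; simp)

lemma extVanishes_of_subsingleton_right [Subsingleton N] (i : ℕ) : ExtVanishes R M N i := by
  refine subsingleton_of_forall_eq 0 fun x ↦ ?_
  rw [← Ext.comp_mk₀_id x, (ModuleCat.isZero_of_subsingleton (ModuleCat.of R N)).eq_of_src (𝟙 _) 0,
    Ext.mk₀_zero, Ext.comp_zero]

lemma extVanishes_of_projective [Module.Projective R M] (i : ℕ) (hi : 0 < i) :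
    ExtVanishes R M N i := by
  obtain ⟨i, rfl⟩ := Nat.exists_eq_succ_of_ne_zero hi.ne'
  have : Projective (ModuleCat.of R M) := (IsProjective.iff_projective M).1 inferInstance
  exact Ext.subsingleton_of_projective _ _ i

lemma extVanishes_of_injective [Module.Injective R N] (i : ℕ) (hi : 0 < i) :
    ExtVanishes R M N i := by
  obtain ⟨i, rfl⟩ := Nat.exists_eq_succ_of_ne_zero hi.ne'
  have : Injective (ModuleCat.of R N) := Module.injective_object_of_injective_module R N
  exact Ext.subsingleton_of_injective _ _ i

lemma HasSES.extVanishes_right₂ (h : HasSES R A B C) {i : ℕ} (hA : ExtVanishes R M A i)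
    (hC : ExtVanishes R M C i) : ExtVanishes R M B i := by
  obtain ⟨f, g, w, hS⟩ := h.exists_shortExact
  refine subsingleton_of_forall_eq 0 fun x ↦ ?_
  obtain ⟨y, rfl⟩ := Ext.covariant_sequence_exact₂ _ hS x (hC.elim _ _)
  rw [hA.elim y 0, Ext.zero_comp]

lemma HasSES.extVanishes_right₃ (h : HasSES R A B C) {i : ℕ} (hB : ExtVanishes R M B i)
    (hA : ExtVanishes R M A (i + 1)) : ExtVanishes R M C i := by
  obtain ⟨f, g, w, hS⟩ := h.exists_shortExact
  refine subsingleton_of_forall_eq 0 fun x ↦ ?_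
  obtain ⟨y, rfl⟩ := Ext.covariant_sequence_exact₃ _ hS x rfl (hA.elim _ _)
  rw [hB.elim y 0, Ext.zero_comp]

lemma HasSES.extVanishes_right₁ (h : HasSES R A B C) {i : ℕ} (hC : ExtVanishes R M C i)
    (hB : ExtVanishes R M B (i + 1)) : ExtVanishes R M A (i + 1) := by
  obtain ⟨f, g, w, hS⟩ := h.exists_shortExact
  refine subsingleton_of_forall_eq 0 fun x ↦ ?_
  obtain ⟨y, rfl⟩ := Ext.covariant_sequence_exact₁ _ hS x (hB.elim _ _) rfl
  rw [hC.elim y 0, Ext.zero_comp]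

lemma HasSES.extVanishes_left₁ (h : HasSES R A B C) {i : ℕ} (hB : ExtVanishes R B N i)
    (hC : ExtVanishes R C N (i + 1)) : ExtVanishes R A N i := by
  obtain ⟨f, g, w, hS⟩ := h.exists_shortExact
  refine subsingleton_of_forall_eq 0 fun x ↦ ?_
  obtain ⟨y, rfl⟩ := Ext.contravariant_sequence_exact₁ hS _ x (add_comm 1 i) (hC.elim _ _)
  rw [hB.elim y 0, Ext.comp_zero]

lemma HasSES.extVanishes_left₃ (h : HasSES R A B C) {i : ℕ} (hA : ExtVanishes R A N i)
    (hB : ExtVanishes R B N (i + 1)) : ExtVanishes R C N (i + 1) := by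
  obtain ⟨f, g, w, hS⟩ := h.exists_shortExact
  refine subsingleton_of_forall_eq 0 fun x ↦ ?_
  obtain ⟨y, rfl⟩ := Ext.contravariant_sequence_exact₃ hS _ x (hB.elim _ _) (add_comm 1 i)
  rw [hA.elim y 0, Ext.comp_zero]

/-- If `Ext¹(C, N) = 0`, then linear maps to `N` extend along monomorphisms with cokernel `C`. -/
lemma ExtVanishes.exists_extension (h : ExtVanishes R C N 1) (f : A →ₗ[R] B) (g : B →ₗ[R] C)
    (hf : Function.Injective f) (hfg : Function.Exact f g) (hg : Function.Surjective g)
    (φ : A →ₗ[R] N) : ∃ ψ : B →ₗ[R] N, ψ ∘ₗ f = φ := by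
  have w : ModuleCat.ofHom f ≫ ModuleCat.ofHom g = 0 := by
    ext x; exact hfg.apply_apply_eq_zero x
  have hS : (ShortComplex.mk _ _ w).ShortExact := ModuleCat.shortComplex_shortExact _ hfg hf hg
  obtain ⟨y, hy⟩ := Ext.contravariant_sequence_exact₁ hS _ (Ext.mk₀ (ModuleCat.ofHom φ))
    (add_zero 1) (h.elim _ _)
  obtain ⟨ψ, rfl⟩ := Ext.addEquiv₀.symm.surjective y
  refine ⟨ψ.hom, ?_⟩
  simp only [Ext.addEquiv₀_symm_apply, Ext.mk₀_comp_mk₀] at hy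
  have := (Ext.addEquiv₀.symm.injective (a₁ := ModuleCat.ofHom f ≫ ψ) (a₂ := ModuleCat.ofHom φ)
    (by simpa using hy))
  exact congr_arg ModuleCat.Hom.hom this

/-- If `B` is projective and linear maps to `N` extend along `f : A → B`, then
`Ext¹(B / A, N) = 0`. -/
lemma extVanishes_one_of_exists_extension [Module.Projective R B] (f : A →ₗ[R] B) (g : B →ₗ[R] C)
    (hf : Function.Injective f) (hfg : Function.Exact f g) (hg : Function.Surjective g)
    (h : ∀ φ : A →ₗ[R] N, ∃ ψ : B →ₗ[R] N, ψ ∘ₗ f = φ) : ExtVanishes R C N 1 := by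
  have w : ModuleCat.ofHom f ≫ ModuleCat.ofHom g = 0 := by
    ext x; exact hfg.apply_apply_eq_zero x
  have hS : (ShortComplex.mk _ _ w).ShortExact := ModuleCat.shortComplex_shortExact _ hfg hf hg
  refine subsingleton_of_forall_eq 0 fun x ↦ ?_
  have hB : ExtVanishes R B N 1 := extVanishes_of_projective 1 one_pos
  obtain ⟨y, rfl⟩ := Ext.contravariant_sequence_exact₃ hS _ x (hB.elim _ _) (add_zero 1)
  obtain ⟨φ, rfl⟩ := Ext.addEquiv₀.symm.surjective y
  obtain ⟨ψ, hψ⟩ := h φ.hom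
  have : φ = ModuleCat.ofHom f ≫ ModuleCat.ofHom ψ := by
    rw [← ModuleCat.ofHom_comp, hψ]; rfl
  rw [Ext.addEquiv₀_symm_apply, this, ← Ext.mk₀_comp_mk₀]
  exact hS.extClass_comp_assoc _

lemma extVanishes_pi_right (a : ℕ) {i : ℕ} (h : ExtVanishes R M N i) :
    ExtVanishes R M (Fin a → N) i := by
  induction a with
  | zero => exact extVanishes_of_subsingleton_right i
  | succ a ih =>
    have hses : HasSES R N (N × (Fin a → N)) (Fin a → N) :=
      ⟨LinearMap.inl R _ _, LinearMap.snd R _ _, LinearMap.inl_injective,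
        .inl_snd, LinearMap.snd_surjective⟩
    exact (hses.extVanishes_right₂ h ih).congr_right (Fin.consLinearEquiv R fun _ ↦ N).symm

lemma ExtVanishes.of_pi {a : ℕ} (ha : a ≠ 0) {i : ℕ} (h : ExtVanishes R M (Fin a → N) i) :
    ExtVanishes R M N i := by
  have : NeZero a := ⟨ha⟩
  exact h.of_retract_right (LinearMap.single R (fun _ ↦ N) 0) (LinearMap.proj 0)
    (by ext; simp)

end ExtVanishing

/-! ### Totally reflexive modules and the modules acyclic for them. -/

section TotallyReflexive

variable {R : Type u} [CommRing R]
variable {A B C M N : Type u} [AddCommGroup A] [Module R A] [AddCommGroup B] [Module R B]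
    [AddCommGroup C] [Module R C] [AddCommGroup M] [Module R M] [AddCommGroup N] [Module R N]

lemma exact_dualMap {f : A →ₗ[R] B} {g : B →ₗ[R] C} (hfg : Function.Exact f g)
    (hg : Function.Surjective g) : Function.Exact g.dualMap f.dualMap := by
  intro φ
  constructor
  · intro hφ
    have hker : LinearMap.ker g ≤ LinearMap.ker φ := by
      intro b hb
      obtain ⟨a, rfl⟩ := (hfg b).1 hb
      exact LinearMap.congr_fun hφ a
    refine ⟨(LinearMap.ker g).liftQ φ hker ∘ₗ (g.quotKerEquivOfSurjective hg).symm, ?_⟩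
    ext b
    have : (g.quotKerEquivOfSurjective hg).symm (g b) = Submodule.Quotient.mk b := by
      rw [LinearEquiv.symm_apply_eq]; rfl
    simp [this]
  · rintro ⟨ψ, rfl⟩
    ext a
    simp [hfg.apply_apply_eq_zero]

lemma HasSES.dual (h : HasSES R A B C) (hC : ExtVanishes R C R 1) :
    HasSES R (Module.Dual R C) (Module.Dual R B) (Module.Dual R A) := by
  obtain ⟨f, g, hf, hfg, hg⟩ := h
  exact ⟨g.dualMap, f.dualMap, LinearMap.dualMap_injective_of_surjective hg,
    exact_dualMap hfg hg, fun φ ↦ hC.exists_extension f g hf hfg hg φ⟩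

lemma IsTotallyReflexive.dual [IsNoetherianRing R] (h : IsTotallyReflexive R A) :
    IsTotallyReflexive R (Module.Dual R A) where
  finite := have := h.finite; inferInstance
  reflexive := have := h.reflexive; inferInstance
  ext_self := h.ext_dual
  ext_dual i hi := have := h.reflexive; (h.ext_self i hi).congr_left (Module.evalEquiv R A).symm

lemma IsTotallyReflexive.ker [IsNoetherianRing R] (h : IsTotallyReflexive R A)
    [Module.Finite R B] [Module.Projective R B] (π : B →ₗ[R] A) (hπ : Function.Surjective π) :
    IsTotallyReflexive R (LinearMap.ker π) := by
  have := h.reflexive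
  have hK := hasSES_ker π hπ
  have hexact : Function.Exact (LinearMap.ker π).subtype π := LinearMap.exact_subtype_ker_map π
  have hrestr : Function.Surjective (LinearMap.ker π).subtype.dualMap := fun φ ↦
    (h.ext_self 1 one_pos).exists_extension _ π Subtype.val_injective hexact hπ φ
  have hdual : Function.Exact π.dualMap (LinearMap.ker π).subtype.dualMap := exact_dualMap hexact hπ
  refine ⟨inferInstance, ⟨⟨?_, ?_⟩⟩, fun i hi ↦ ?_, fun i hi ↦ ?_⟩
  · rw [injective_iff_map_eq_zero]
    intro x hx
    apply Subtype.ext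
    apply (Module.bijective_dual_eval R B).injective
    ext f
    simpa using LinearMap.congr_fun hx (f ∘ₗ (LinearMap.ker π).subtype)
  · intro φ
    obtain ⟨x, hx⟩ := (Module.bijective_dual_eval R B).surjective
      (φ ∘ₗ (LinearMap.ker π).subtype.dualMap)
    have hx' : ∀ f : Module.Dual R B, f x = φ ((LinearMap.ker π).subtype.dualMap f) :=
      fun f ↦ LinearMap.congr_fun hx f
    have hxK : π x = 0 := by
      apply (Module.bijective_dual_eval R A).injective
      ext g
      have := hx' (π.dualMap g)
      rw [hdual.apply_apply_eq_zero, map_zero] at this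
      simpa using this
    refine ⟨⟨x, hxK⟩, ?_⟩
    ext f
    obtain ⟨f, rfl⟩ := hrestr f
    exact hx' f
  · exact hK.extVanishes_left₁ (extVanishes_of_projective i hi) (h.ext_self _ i.succ_pos)
  · obtain ⟨i, rfl⟩ := Nat.exists_eq_succ_of_ne_zero hi.ne'
    rcases Nat.eq_zero_or_pos i with rfl | hi'
    -- Degree one is not reached by shifting. A functional on `A*` is evaluation at some `a`, and
    -- evaluation at a lift of `a` to `B` extends it to `B*`.
    · refine extVanishes_one_of_exists_extension π.dualMap (LinearMap.ker π).subtype.dualMap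
        (LinearMap.dualMap_injective_of_surjective hπ) hdual hrestr fun φ ↦ ?_
      obtain ⟨a, rfl⟩ := (Module.bijective_dual_eval R A).surjective φ
      obtain ⟨b, rfl⟩ := hπ a
      exact ⟨Module.Dual.eval R B b, by ext; rfl⟩
    · exact (hK.dual (h.ext_self 1 one_pos)).extVanishes_left₃ (h.ext_dual i hi')
        (extVanishes_of_projective _ i.succ_pos)

/-- Dualize `0 → K → Rⁿ → A* → 0` and identify `A**` with `A`; the cokernel is `K*`. -/
lemma IsTotallyReflexive.exists_hasSES_projective [IsNoetherianRing R]
    (h : IsTotallyReflexive R A) :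
    ∃ (F G : ModuleCat.{u} R), Module.Projective R F ∧ HasSES R A F G ∧
      IsTotallyReflexive R G := by
  have := h.reflexive
  have := h.finite
  obtain ⟨n, π, hπ⟩ := Module.Finite.exists_fin' R (Module.Dual R A)
  have hK := h.dual.ker π hπ
  have hses := (hasSES_ker π hπ).dual (h.ext_dual 1 one_pos)
  obtain ⟨f, g, hf, hfg, hg⟩ := hses
  refine ⟨ModuleCat.of R (Module.Dual R (Fin n → R)),
    ModuleCat.of R (Module.Dual R (LinearMap.ker π)), inferInstanceAs (Module.Projective R
      (Module.Dual R (Fin n → R))), ⟨f ∘ₗ (Module.evalEquiv R A).toLinearMap, g, ?_, ?_, hg⟩,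
      hK.dual⟩
  · exact hf.comp (Module.evalEquiv R A).injective
  · intro x
    rw [hfg x]
    constructor
    · rintro ⟨y, rfl⟩
      exact ⟨(Module.evalEquiv R A).symm y,
        congr_arg f ((Module.evalEquiv R A).apply_symm_apply y)⟩
    · rintro ⟨y, rfl⟩
      exact ⟨_, rfl⟩

/-- `Ext` of a finitely generated module with values in projective modules vanishes if it vanishes
with values in the ring. -/
lemma extVanishes_projective_right [IsNoetherianRing R] [Module.Finite R A]
    (h : ∀ i : ℕ, 0 < i → ExtVanishes R A R i) [Module.Projective R N] (i : ℕ) (hi : 0 < i) :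
    ExtVanishes R A N i := by
  suffices hfree : ExtVanishes R A (N →₀ R) i by
    obtain ⟨s, hs⟩ := Module.projective_def.1 ‹Module.Projective R N›
    exact hfree.of_retract_right s (Finsupp.linearCombination R id) (by ext x; exact hs x)
  obtain ⟨i, rfl⟩ := Nat.exists_eq_succ_of_ne_zero hi.ne'
  clear hi
  induction i generalizing A with
  | zero =>
    obtain ⟨n, π, hπ⟩ := Module.Finite.exists_fin' R A
    refine extVanishes_one_of_exists_extension (LinearMap.ker π).subtype π Subtype.val_injective
      (LinearMap.exact_subtype_ker_map π) hπ fun φ ↦ ?_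
    classical
    -- The kernel is finitely generated, so `φ` meets only finitely many coordinates; each is
    -- extended separately and the extensions are summed.
    obtain ⟨S, hS⟩ : ∃ S : Finset N, ∀ x, φ x ∈ Finsupp.supported R R (S : Set N) := by
      obtain ⟨T, hT⟩ := (inferInstance : Module.Finite R (LinearMap.ker π)).fg_top
      refine ⟨T.biUnion fun t ↦ (φ t).support, fun x ↦ ?_⟩
      have hx : x ∈ Submodule.span R (T : Set (LinearMap.ker π)) := hT ▸ Submodule.mem_top
      induction hx using Submodule.span_induction with
      | mem x hx =>
        rw [Finsupp.mem_supported]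
        exact Finset.coe_subset.2 (Finset.subset_biUnion_of_mem (fun t ↦ (φ t).support) hx)
      | zero => rw [map_zero]; exact Submodule.zero_mem _
      | add x y _ _ hx hy => rw [map_add]; exact Submodule.add_mem _ hx hy
      | smul r x _ hx => rw [map_smul]; exact Submodule.smul_mem _ r hx
    have hcomp (s : N) := (h 1 one_pos).exists_extension (LinearMap.ker π).subtype π
      Subtype.val_injective (LinearMap.exact_subtype_ker_map π) hπ (Finsupp.lapply s ∘ₗ φ)
    choose ψ hψ using hcomp
    refine ⟨∑ s ∈ S, Finsupp.lsingle s ∘ₗ ψ s, ?_⟩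
    ext x : 1
    have hx : ∀ s, ψ s x = φ x s := fun s ↦ LinearMap.congr_fun (hψ s) x
    have hsupp : (φ x).support ⊆ S := Finset.coe_subset.1 ((Finsupp.mem_supported _ _).1 (hS x))
    simp only [LinearMap.comp_apply, Submodule.subtype_apply, LinearMap.sum_apply, hx,
      Finsupp.lsingle_apply]
    conv_rhs => rw [← Finsupp.sum_single (φ x)]
    rw [Finsupp.sum_of_support_subset _ hsupp _ (by simp)]
  | succ i ih =>
    obtain ⟨n, π, hπ⟩ := Module.Finite.exists_fin' R A
    have hK := hasSES_ker π hπ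
    exact hK.extVanishes_left₃ (ih fun j hj ↦ hK.extVanishes_left₁
      (extVanishes_of_projective j hj) (h _ j.succ_pos)) (extVanishes_of_projective _ (by omega))

variable (R) in
/-- Modules `W` such that `Extⁱ(G, W) = 0` for all `i > 0` and all totally reflexive `G`. -/
def IsTRAcyclic (W : Type u) [AddCommGroup W] [Module R W] : Prop :=
  ∀ G : ModuleCat.{u} R, IsTotallyReflexive R G → ∀ i : ℕ, 0 < i → ExtVanishes R G W i

lemma isTRAcyclic_of_subsingleton [Subsingleton A] : IsTRAcyclic R A :=
  fun _ _ i _ ↦ extVanishes_of_subsingleton_right i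

lemma isTRAcyclic_of_projective [IsNoetherianRing R] [Module.Projective R A] :
    IsTRAcyclic R A := fun _ hG i hi ↦
  have := hG.finite
  extVanishes_projective_right hG.ext_self i hi

lemma isTRAcyclic_of_injective [Module.Injective R A] : IsTRAcyclic R A :=
  fun _ _ i hi ↦ extVanishes_of_injective i hi

lemma HasSES.isTRAcyclic₃ (h : HasSES R A B C) (hA : IsTRAcyclic R A) (hB : IsTRAcyclic R B) :
    IsTRAcyclic R C :=
  fun G hG i hi ↦ h.extVanishes_right₃ (hB G hG i hi) (hA G hG _ i.succ_pos)

/-- The long exact sequence alone misses `Ext¹(G, A)`. Embedding `G` in a projective with totally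
reflexive cokernel `G'` reduces `Extⁱ(G, A)` to `Extⁱ⁺¹(G', A)`, where it applies. -/
lemma HasSES.isTRAcyclic₁ [IsNoetherianRing R] (h : HasSES R A B C) (hB : IsTRAcyclic R B)
    (hC : IsTRAcyclic R C) : IsTRAcyclic R A := by
  intro G hG i hi
  obtain ⟨F, G', hF, hses, hG'⟩ := hG.exists_hasSES_projective
  exact hses.extVanishes_left₁ (extVanishes_of_projective i hi)
    (h.extVanishes_right₁ (hC G' hG' i hi) (hB G' hG' _ i.succ_pos))

lemma HasSES.isTRAcyclic₂ (h : HasSES R A B C) (hA : IsTRAcyclic R A) (hC : IsTRAcyclic R C) :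
    IsTRAcyclic R B :=
  fun G hG i hi ↦ h.extVanishes_right₂ (hA G hG i hi) (hC G hG i hi)

/-- `Extⁱ(M, W) = 0` for `i > G-dim M` whenever `W` is acyclic for totally reflexive modules. -/
lemma IsTRAcyclic.extVanishes [IsNoetherianRing R] {W : Type u} [AddCommGroup W] [Module R W]
    (hW : IsTRAcyclic R W) {n : ℕ} (hM : HasTotallyReflexiveResolution R M n) (i : ℕ)
    (hi : n < i) : ExtVanishes R M W i := by
  induction n generalizing M i with
  | zero =>
    obtain ⟨G, d, ε, hG, hG', hε, hε', hd⟩ := hM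
    have := hG' 1 one_pos
    -- Since `G 1 = 0`, the augmentation is an isomorphism.
    have hinj : Function.Injective ε := by
      rw [injective_iff_map_eq_zero]
      intro x hx
      obtain ⟨y, rfl⟩ := (hε' x).1 hx
      rw [Subsingleton.elim y 0, map_zero]
    exact (hW _ (hG 0 le_rfl) i hi).congr_left (LinearEquiv.ofBijective ε ⟨hinj, hε⟩).symm
  | succ n ih =>
    obtain ⟨G, d, ε, hG, hG', hε, hε', hd⟩ := hM
    obtain ⟨i, rfl⟩ := Nat.exists_eq_succ_of_ne_zero (by omega : i ≠ 0)
    have hK : HasTotallyReflexiveResolution R (LinearMap.ker ε) n := by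
      refine ⟨fun i ↦ G (i + 1), fun i ↦ d (i + 1),
        (d 0).codRestrict (LinearMap.ker ε) fun x ↦ hε'.apply_apply_eq_zero x,
        fun i hi ↦ hG _ (by omega), fun i hi ↦ hG' _ (by omega), ?_, ?_, fun i ↦ hd _⟩
      · rintro ⟨x, hx⟩
        obtain ⟨y, rfl⟩ := (hε' x).1 hx
        exact ⟨y, rfl⟩
      · intro x
        rw [← hd 0 x, Subtype.ext_iff]
        rfl
    exact (hasSES_ker ε hε).extVanishes_left₃ (ih hK i (by omega))
      (hW _ (hG 0 (Nat.zero_le _)) _ i.succ_pos)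

end TotallyReflexive

/-! ### Rigidity from a window of vanishing `Ext`. -/

section Window

variable {R : Type u} [CommRing R]
variable {Z B C H : ℤ → ModuleCat.{u} R} (hZC : ∀ i j, j + 1 = i → HasSES R (Z i) (C i) (B j))
  (hBZ : ∀ i, HasSES R (B i) (Z i) (H i)) (hC : ∀ i, IsTRAcyclic R (C i))

include hZC hBZ hC

/-- In a bounded below complex of acyclic modules, the cycles are acyclic up to the least degree
with nonzero homology. -/
lemma isTRAcyclic_cycles [IsNoetherianRing R] {l t : ℤ} (hl : ∀ i < l, Subsingleton (C i))
    (ht : ∀ i < t, Subsingleton (H i)) (i : ℤ) (hi : i ≤ t) : IsTRAcyclic R (Z i) := by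
  have key (k : ℕ) : ∀ i : ℤ, i < l + k → i ≤ t → IsTRAcyclic R (Z i) := by
    induction k with
    | zero =>
      intro i hil _
      obtain ⟨f, -, hf, -⟩ := hZC i (i - 1) (by ring)
      have := hl i (by simpa using hil)
      have := hf.subsingleton
      exact isTRAcyclic_of_subsingleton
    | succ k ih =>
      intro i hil hit
      have := ht (i - 1) (by omega)
      exact (hZC i (i - 1) (by ring)).isTRAcyclic₁ (hC i) ((hBZ (i - 1)).isTRAcyclic₁
        (ih (i - 1) (by omega) (by omega)) isTRAcyclic_of_subsingleton)
  exact key (i - l + 1).toNat i (by omega) hi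

/-- In a bounded above complex of acyclic modules, the boundaries are acyclic from the greatest
degree with nonzero homology on. -/
lemma isTRAcyclic_boundaries {u s : ℤ} (hu : ∀ i, u < i → Subsingleton (C i))
    (hs : ∀ i, s < i → Subsingleton (H i)) (i : ℤ) (hi : s ≤ i) : IsTRAcyclic R (B i) := by
  have key (k : ℕ) : ∀ i : ℤ, u - k < i → s ≤ i → IsTRAcyclic R (B i) := by
    induction k with
    | zero =>
      intro i hui _
      obtain ⟨f, -, hf, -⟩ := hZC i (i - 1) (by ring)
      obtain ⟨f', -, hf', -⟩ := hBZ i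
      have := hu i (by simpa using hui)
      have := hf.subsingleton
      have := hf'.subsingleton
      exact isTRAcyclic_of_subsingleton
    | succ k ih =>
      intro i hui hsi
      have := hs (i + 1) (by omega)
      exact (hZC (i + 1) i rfl).isTRAcyclic₃ ((hBZ (i + 1)).isTRAcyclic₂
        (ih (i + 1) (by omega) (by omega)) isTRAcyclic_of_subsingleton) (hC (i + 1))
  exact key (u - i + 1).toNat i (by omega) hi

variable [IsNoetherianRing R] {M L : Type u} [AddCommGroup M] [Module R M] [AddCommGroup L] [Module R L]
  {a : ℤ → ℕ} (hH : ∀ i, Nonempty (H i ≃ₗ[R] (Fin (a i) → L)))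
  {t : ℤ} {w g : ℕ} (hM : HasTotallyReflexiveResolution R M g)
  (hZt : IsTRAcyclic R (Z t)) (hBs : IsTRAcyclic R (B (t + w)))

include hH hM hZt hBs

/-- Climbing one homological degree raises the `Ext` degree by one: vanishing passes from `Z` to `B`
using the homology one `Ext` degree lower, then to the next `Z`. At the top, acyclic boundaries
transfer it to `H (t + w)`, a nonzero power of `L`. -/
lemma extVanishes_above_window (hs : a (t + w) ≠ 0) {m : ℕ} (hm : g < m)
    (hwin : ∀ j, m ≤ j → j ≤ m + w → ExtVanishes R M L j) : ExtVanishes R M L (m + w + 1) := by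
  have hHvan (i : ℤ) (j : ℕ) (h1 : m ≤ j) (h2 : j ≤ m + w) : ExtVanishes R M (H i) j :=
    (extVanishes_pi_right (a i) (hwin j h1 h2)).congr_right (hH i).some
  have key (k : ℕ) (hk : k ≤ w) : ExtVanishes R M (Z (t + k)) (m + k + 1) := by
    induction k with
    | zero =>
      rw [Nat.cast_zero, add_zero]
      exact hZt.extVanishes hM _ (by omega)
    | succ k ih =>
      refine (hZC (t + (k + 1 : ℕ)) (t + k) (by push_cast; ring)).extVanishes_right₁ ?_
        ((hC _).extVanishes hM _ (by omega))
      exact (hBZ _).extVanishes_right₁ (hHvan _ (m + k) (by omega) (by omega)) (ih (by omega))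
  exact (((hBZ _).extVanishes_right₃ (key w le_rfl)
    (hBs.extVanishes hM _ (by omega))).congr_right (hH _).some.symm).of_pi hs

/-- The same ladder descended from the acyclic boundaries in degree `t + w`; the acyclic cycles in
degree `t` transfer the result to `H t`. -/
lemma extVanishes_below_window (ht : a t ≠ 0) {p : ℕ} (hp : g < p)
    (hwin : ∀ j, p + 1 ≤ j → j ≤ p + 1 + w → ExtVanishes R M L j) : ExtVanishes R M L p := by
  have hHvan (i : ℤ) (j : ℕ) (h1 : p + 1 ≤ j) (h2 : j ≤ p + 1 + w) : ExtVanishes R M (H i) j :=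
    (extVanishes_pi_right (a i) (hwin j h1 h2)).congr_right (hH i).some
  have key (k l : ℕ) (hk : l + k = w) : ExtVanishes R M (B (t + l)) (p + 1 + l) := by
    induction k generalizing l with
    | zero =>
      obtain rfl : l = w := by omega
      exact hBs.extVanishes hM _ (by omega)
    | succ k ih =>
      refine (hZC (t + (l + 1 : ℕ)) (t + l) (by push_cast; ring)).extVanishes_right₃
        ((hC _).extVanishes hM _ (by omega)) ?_
      exact (hBZ _).extVanishes_right₂ (ih (l + 1) (by omega))
        (hHvan _ _ (by omega) (by omega))
  have hB := key w 0 (by omega)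
  rw [Nat.cast_zero, add_zero, add_zero] at hB
  exact (((hBZ t).extVanishes_right₃ (hZt.extVanishes hM p hp) hB).congr_right
    (hH t).some.symm).of_pi ht

omit hZt hBs in
/-- Rigidity of `Ext` with values in a module `L` that is, up to finite powers, the homology of a
bounded complex of acyclic modules whose homology lives in degrees `t, …, t + w`. -/
lemma extVanishes_of_window {l u : ℤ} (hl : ∀ i < l, Subsingleton (C i))
    (hu : ∀ i, u < i → Subsingleton (C i)) (hlt : ∀ i < t, a i = 0)
    (hgt : ∀ i, t + w < i → a i = 0) (ht : a t ≠ 0) (hs : a (t + w) ≠ 0) {n : ℕ} (hn : g < n)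
    (hwin : ∀ j, n ≤ j → j ≤ n + w → ExtVanishes R M L j) (i : ℕ) (hi : g < i) :
    ExtVanishes R M L i := by
  have hsub (i : ℤ) (h : a i = 0) : Subsingleton (H i) := by
    have : IsEmpty (Fin (a i)) := by rw [h]; infer_instance
    exact (hH i).some.injective.subsingleton
  have hZt := isTRAcyclic_cycles hZC hBZ hC hl (fun i hi ↦ hsub i (hlt i hi)) t le_rfl
  have hBs := isTRAcyclic_boundaries hZC hBZ hC hu (fun i hi ↦ hsub i (hgt i hi)) (t + w) le_rfl
  have up (k : ℕ) : ∀ j, n ≤ j → j ≤ n + w + k → ExtVanishes R M L j := by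
    induction k with
    | zero => exact hwin
    | succ k ih =>
      intro j h1 h2
      rcases h2.lt_or_eq with h2 | rfl
      · exact ih j h1 (by omega)
      -- The window is moved up to start at `n + k`, so its successor is the new degree.
      · have := extVanishes_above_window hZC hBZ hC hH hM hZt hBs hs (m := n + k) (by omega)
          fun j h1 h2 ↦ ih j (by omega) (by omega)
        convert this using 1
        ring
  have down (k : ℕ) : ∀ j, g < j → n ≤ j + k → ExtVanishes R M L j := by
    induction k with
    | zero => exact fun j _ h2 ↦ up j j h2 (by omega)
    | succ k ih =>
      exact fun j h1 h2 ↦ extVanishes_below_window hZC hBZ hC hH hM hZt hBs ht h1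
        fun j' h1' h2' ↦ ih j' (by omega) (by omega)
  exact down n i hi (by omega)

end Window

/-! ### Cycles, boundaries and homology of a complex. -/

section ComplexSES

variable {R : Type u} [CommRing R]

lemma hasSES_boundaries_cycles_homology (S : ShortComplex (ModuleCat.{u} R)) :
    HasSES R (LinearMap.range S.f.hom) (LinearMap.ker S.g.hom) S.homology := by
  have hle : LinearMap.range S.f.hom ≤ LinearMap.ker S.g.hom := by
    rintro _ ⟨x, rfl⟩
    exact S.moduleCat_zero_apply x
  let e : S.homology ≃ₗ[R] (LinearMap.ker S.g.hom ⧸ LinearMap.range S.moduleCatToCycles) :=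
    S.moduleCatHomologyIso.toLinearEquiv
  refine ⟨Submodule.inclusion hle, e.symm.toLinearMap ∘ₗ Submodule.mkQ _,
    Submodule.inclusion_injective hle, fun x ↦ ?_, e.symm.surjective.comp (Submodule.mkQ_surjective _)⟩
  simp only [LinearMap.comp_apply, LinearEquiv.coe_coe, EmbeddingLike.map_eq_zero_iff,
    Submodule.mkQ_apply, Submodule.Quotient.mk_eq_zero]
  constructor
  · rintro ⟨y, rfl⟩
    exact ⟨⟨_, y, rfl⟩, rfl⟩
  · rintro ⟨⟨_, y, rfl⟩, rfl⟩
    exact ⟨y, rfl⟩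

/-- Counterpart of `hasSES_boundaries_cycles_homology` for dualizing: the characters of `X₂ / im f`
are the cycles of the dual complex. -/
lemma hasSES_homology_quotient_boundaries (S : ShortComplex (ModuleCat.{u} R)) :
    HasSES R S.homology (S.X₂ ⧸ LinearMap.range S.f.hom) (LinearMap.range S.g.hom) := by
  let e : S.homology ≃ₗ[R] (LinearMap.ker S.g.hom ⧸ LinearMap.range S.moduleCatToCycles) :=
    S.moduleCatHomologyIso.toLinearEquiv
  let i : (LinearMap.ker S.g.hom ⧸ LinearMap.range S.moduleCatToCycles) →ₗ[R]
      (S.X₂ ⧸ LinearMap.range S.f.hom) :=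
    Submodule.mapQ _ _ (LinearMap.ker S.g.hom).subtype (by
      rintro _ ⟨y, rfl⟩
      exact ⟨y, rfl⟩)
  let p : (S.X₂ ⧸ LinearMap.range S.f.hom) →ₗ[R] LinearMap.range S.g.hom :=
    Submodule.liftQ _ S.g.hom.rangeRestrict (by
      rintro _ ⟨y, rfl⟩
      exact Subtype.ext (S.moduleCat_zero_apply y))
  refine ⟨i ∘ₗ e.toLinearMap, p, (show Function.Injective i from ?_).comp e.injective, fun x ↦ ?_, ?_⟩
  · rw [injective_iff_map_eq_zero]
    intro x hx
    obtain ⟨x, rfl⟩ := Submodule.mkQ_surjective _ x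
    obtain ⟨y, hy⟩ := (Submodule.Quotient.mk_eq_zero _).1 hx
    exact (Submodule.Quotient.mk_eq_zero _).2 ⟨y, Subtype.ext hy⟩
  · obtain ⟨x, rfl⟩ := Submodule.mkQ_surjective _ x
    constructor
    · intro hx
      refine ⟨e.symm (Submodule.mkQ _ ⟨x, congr_arg Subtype.val hx⟩), ?_⟩
      simp only [LinearMap.comp_apply, LinearEquiv.coe_coe, LinearEquiv.apply_symm_apply]
      rfl
    · rintro ⟨y, hy⟩
      rw [← hy]
      obtain ⟨z, hz⟩ := Submodule.mkQ_surjective _ (e y)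
      simp only [LinearMap.comp_apply, LinearEquiv.coe_coe, ← hz]
      exact Subtype.ext z.2
  · rintro ⟨_, x, rfl⟩
    exact ⟨Submodule.mkQ _ x, rfl⟩

variable (P : ChainComplex (ModuleCat.{u} R) ℤ)

lemma hasSES_chainComplex_cycles (i j : ℤ) (hij : j + 1 = i) :
    HasSES R (LinearMap.ker (P.d i (i - 1)).hom) (P.X i) (LinearMap.range (P.d (j + 1) j).hom) := by
  subst hij
  obtain ⟨k, hk⟩ : ∃ k, k = j + 1 - 1 := ⟨_, rfl⟩
  rw [← hk]
  obtain rfl : j = k := by omega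
  exact ⟨Submodule.subtype _, LinearMap.rangeRestrict _, Subtype.val_injective,
    fun x ↦ by simp [Subtype.ext_iff], LinearMap.surjective_rangeRestrict _⟩

/-- Homology of an integrally indexed chain complex, computed from three explicit degrees. -/
noncomputable def homologyEquiv (i : ℤ) :
    P.homology i ≃ₗ[R] (P.sc' (i + 1) i (i - 1)).homology :=
  (ShortComplex.homologyMapIso (P.isoSc' (i + 1) i (i - 1) (by simp) (by simp))).toLinearEquiv

lemma hasSES_chainComplex_homology (i : ℤ) :
    HasSES R (LinearMap.range (P.d (i + 1) i).hom) (LinearMap.ker (P.d i (i - 1)).hom)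
      (P.homology i) :=
  (hasSES_boundaries_cycles_homology (P.sc' (i + 1) i (i - 1))).congr_right (homologyEquiv P i).symm

lemma hasSES_chainComplex_homology' (i : ℤ) :
    HasSES R (P.homology i) (P.X i ⧸ LinearMap.range (P.d (i + 1) i).hom)
      (LinearMap.range (P.d i (i - 1)).hom) :=
  (hasSES_homology_quotient_boundaries (P.sc' (i + 1) i (i - 1))).congr_left (homologyEquiv P i)

/-- The redundant indices `q`, `r` allow use at negated degrees without transport between equal
ones. -/
lemma hasSES_chainComplex_boundaries (p q r : ℤ) (hq : q = p + 1) (hr : r = p) :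
    HasSES R (LinearMap.range (P.d q r).hom) (P.X p)
      (P.X p ⧸ LinearMap.range (P.d (p + 1) p).hom) := by
  subst hq hr
  exact hasSES_quotient _

end ComplexSES

/-! ### From `Tor` to `Ext` by character modules. -/

section CharacterModule

variable {R : Type u} [CommRing R]

/-- The character module of a finite power is the finite power of the character module. -/
def characterModulePiEquiv (R : Type u) [CommRing R] (a : ℕ) (N : Type u) [AddCommGroup N]
    [Module R N] : CharacterModule (Fin a → N) ≃ₗ[R] (Fin a → CharacterModule N) where
  toFun c i := CharacterModule.dual (LinearMap.single R (fun _ ↦ N) i) c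
  map_add' _ _ := by ext; simp; rfl
  map_smul' _ _ := by ext; simp; rfl
  invFun c := ∑ i, CharacterModule.dual (LinearMap.proj (R := R) (φ := fun _ ↦ N) i) (c i)
  left_inv c := by
    ext x
    refine (AddMonoidHom.finsetSum_apply _ _ x).trans ?_
    change ∑ i, c (Pi.single i (x i)) = c x
    rw [← map_sum, Finset.univ_sum_single]
  right_inv c := by
    ext i x
    let y : Fin a → N := Pi.single i x
    refine (AddMonoidHom.finsetSum_apply _ _ y).trans ?_
    change ∑ j, c j (y j) = c i x
    rw [Finset.sum_eq_single i (fun j _ hj ↦ by simp [y, Pi.single_eq_of_ne hj]) (by simp)]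
    simp [y]

/-- Tensor-hom adjunction identifies `Hom(X, N⁺)` with `(X ⊗ N)⁺`, and characters preserve and
reflect exactness. -/
lemma exact_lcomp_characterModule_iff {A B C N : Type u} [AddCommGroup A] [Module R A]
    [AddCommGroup B] [Module R B] [AddCommGroup C] [Module R C] [AddCommGroup N] [Module R N]
    (f : A →ₗ[R] B) (g : B →ₗ[R] C) :
    Function.Exact (g.lcomp R (CharacterModule N)) (f.lcomp R (CharacterModule N)) ↔
      Function.Exact (f.rTensor N) (g.rTensor N) := by
  rw [← exact_characterModule_dual_iff (f := f.rTensor N)]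
  refine (Function.Exact.iff_of_ladder_linearEquiv
    (e₁ := CharacterModule.homEquiv (A := C) (B := N) (R := R))
    (e₂ := CharacterModule.homEquiv (A := B) (B := N) (R := R))
    (e₃ := CharacterModule.homEquiv (A := A) (B := N) (R := R)) ?_ ?_).symm
  · rw [← CharacterModule.dual_rTensor_conj_homEquiv]
    ext
    simp
  · rw [← CharacterModule.dual_rTensor_conj_homEquiv]
    ext
    simp

/-- `Torᵢ(M, N) = 0` if and only if `Extⁱ(M, N⁺) = 0`, where `N⁺` is the character module. -/
lemma torVanishes_iff_extVanishes (M N : Type u) [AddCommGroup M] [Module R M] [AddCommGroup N]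
    [Module R N] (i : ℕ) (hi : 0 < i) :
    TorVanishes R M N i ↔ ExtVanishes R M (CharacterModule N) i := by
  obtain ⟨k, rfl⟩ := Nat.exists_eq_succ_of_ne_zero hi.ne'
  let F := projectiveResolution (ModuleCat.of R M)
  have htor : TorVanishes R M N (k + 1) ↔
      Function.Exact ((F.complex.d (k + 2) (k + 1)).hom.rTensor N)
        ((F.complex.d (k + 1) k).hom.rTensor N) := by
    let T := (MonoidalCategory.tensoringRight (ModuleCat.{u} R)).obj (ModuleCat.of R N)
    let K := (T.mapHomologicalComplex (ComplexShape.down ℕ)).obj F.complex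
    have e : ((Tor' (ModuleCat.{u} R) (k + 1)).obj (ModuleCat.of R M)).obj (ModuleCat.of R N) ≅
      K.homology (k + 1) := F.isoLeftDerivedObj T (k + 1)
    rw [TorVanishes, ← ModuleCat.isZero_iff_subsingleton, e.isZero_iff,
      ← K.exactAt_iff_isZero_homology, K.exactAt_iff' (k + 2) (k + 1) k (by simp) (by simp),
      ShortComplex.ShortExact.moduleCat_exact_iff_function_exact]
    rfl
  have hext : ExtVanishes R M (CharacterModule N) (k + 1) ↔
      Function.Exact ((F.complex.d (k + 1) k).hom.lcomp R (CharacterModule N))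
        ((F.complex.d (k + 2) (k + 1)).hom.lcomp R (CharacterModule N)) := by
    let Y := ModuleCat.of R (CharacterModule N)
    constructor
    · refine fun h φ ↦ ⟨fun hφ ↦ ?_, ?_⟩
      · obtain ⟨ψ, hψ⟩ := (F.extMk_eq_zero_iff (Y := Y) (ModuleCat.ofHom φ) (k + 2) rfl
          (ModuleCat.hom_ext hφ) k rfl).1 (h.elim _ _)
        exact ⟨ψ.hom, congr_arg ModuleCat.Hom.hom hψ⟩
      · rintro ⟨ψ, rfl⟩
        exact congr_arg ModuleCat.Hom.hom (show F.complex.d (k + 2) (k + 1) ≫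
          F.complex.d (k + 1) k ≫ ModuleCat.ofHom (Y := Y) ψ = 0 by simp)
    · refine fun h ↦ subsingleton_of_forall_eq 0 fun x ↦ ?_
      obtain ⟨f, hf, rfl⟩ := F.extMk_surjective x (k + 2) rfl
      obtain ⟨ψ, hψ⟩ := (h f.hom).1 (congr_arg ModuleCat.Hom.hom hf)
      exact (F.extMk_eq_zero_iff f (k + 2) rfl hf k rfl).2
        ⟨ModuleCat.ofHom ψ, ModuleCat.hom_ext hψ⟩
  rw [Nat.succ_eq_add_one, htor, hext, exact_lcomp_characterModule_iff]

end CharacterModule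


/-! ### Integer bounds from the extended real suprema and infima. -/

section Bounds

lemma sSup_intCast_eq {S : ℤ → Prop} {s : ℤ} (hs : S s) (hmax : ∀ i, S i → i ≤ s) :
    sSup {e : EReal | ∃ i : ℤ, S i ∧ e = ((i : ℝ) : EReal)} = ((s : ℝ) : EReal) := by
  refine IsGreatest.csSup_eq ⟨⟨s, hs, rfl⟩, ?_⟩
  rintro _ ⟨i, hi, rfl⟩
  exact_mod_cast hmax i hi

lemma sInf_intCast_eq {S : ℤ → Prop} {s : ℤ} (hs : S s) (hmin : ∀ i, S i → s ≤ i) :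
    sInf {e : EReal | ∃ i : ℤ, S i ∧ e = ((i : ℝ) : EReal)} = ((s : ℝ) : EReal) := by
  refine IsLeast.csInf_eq ⟨⟨s, hs, rfl⟩, ?_⟩
  rintro _ ⟨i, hi, rfl⟩
  exact_mod_cast hmin i hi

variable {R : Type u} [CommRing R] {P : ChainComplex (ModuleCat.{u} R) ℤ}

lemma exists_subsingleton_of_cxSup_lt_top (h : cxSup P < ⊤) :
    ∃ u : ℤ, ∀ i, u < i → Subsingleton (P.X i) := by
  obtain ⟨r, hr, -⟩ := EReal.lt_iff_exists_real_btwn.1 h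
  refine ⟨⌈r⌉, fun i hi ↦ ?_⟩
  by_contra hne
  rw [not_subsingleton_iff_nontrivial] at hne
  have hle : ((i : ℝ) : EReal) ≤ cxSup P := le_sSup ⟨i, hne, rfl⟩
  have := hle.trans_lt hr
  rw [EReal.coe_lt_coe_iff] at this
  have h1 := Int.le_ceil r
  have h2 : ((⌈r⌉ : ℤ) : ℝ) < i := by exact_mod_cast hi
  linarith

lemma exists_subsingleton_of_bot_lt_cxInf (h : ⊥ < cxInf P) :
    ∃ l : ℤ, ∀ i < l, Subsingleton (P.X i) := by
  obtain ⟨r, -, hr⟩ := EReal.lt_iff_exists_real_btwn.1 h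
  refine ⟨⌊r⌋, fun i hi ↦ ?_⟩
  by_contra hne
  rw [not_subsingleton_iff_nontrivial] at hne
  have hle : cxInf P ≤ ((i : ℝ) : EReal) := sInf_le ⟨i, hne, rfl⟩
  have := hr.trans_le hle
  rw [EReal.coe_lt_coe_iff] at this
  have h1 := Int.floor_le r
  have h2 : (i : ℝ) < (⌊r⌋ : ℤ) := by exact_mod_cast hi
  linarith

lemma subsingleton_homology (i : ℤ) [Subsingleton (P.X i)] : Subsingleton (P.homology i) := by
  obtain ⟨f, -, hf, -⟩ := hasSES_chainComplex_homology' P i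
  have : Subsingleton (P.X i ⧸ LinearMap.range (P.d (i + 1) i).hom) :=
    (Submodule.mkQ_surjective _).subsingleton
  exact hf.subsingleton

end Bounds

end QuasiProj

/-! ### The theorem. -/

open QuasiProj in
theorem theorem6p11 (R : Type u) [CommRing R] [IsNoetherianRing R]
    (M : Type u) [AddCommGroup M] [Module R M] [Module.Finite R M] [Nontrivial M]
    (N : Type u) [AddCommGroup N] [Module R N] [Nontrivial N]
    (hN : QuasiProj.qpd R N < ⊤)
    (n : ℕ) (hn : 0 < n)
    (P : ChainComplex (ModuleCat.{u} R) ℤ)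
    (hP : QuasiProj.IsFiniteQuasiProjectiveResolution R N P)
    (hM : QuasiProj.gdim R M < (n : ℕ∞)) :
    ((∀ i : ℕ, n ≤ i →
          (i : EReal) ≤ (n : EReal) + (QuasiProj.hsup P - QuasiProj.hinf P) →
          QuasiProj.TorVanishes R M N i) →
        ∀ i : ℕ, QuasiProj.gdim R M < (i : ℕ∞) → QuasiProj.TorVanishes R M N i) ∧
    ((∀ i : ℕ, n ≤ i →
          (i : EReal) ≤ (n : EReal) + (QuasiProj.hsup P - QuasiProj.hinf P) →
          QuasiProj.ExtVanishes R M N i) →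
        ∀ i : ℕ, QuasiProj.gdim R M < (i : ℕ∞) → QuasiProj.ExtVanishes R M N i) := by
  obtain ⟨g, hg, hgM⟩ : ∃ g : ℕ, HasTotallyReflexiveResolution R M g ∧ gdim R M = g := by
    refine csInf_mem (s := {e : ℕ∞ | ∃ n : ℕ, HasTotallyReflexiveResolution R M n ∧ e = n}) ?_
    by_contra hne
    rw [Set.not_nonempty_iff_eq_empty] at hne
    rw [gdim, hne, sInf_empty] at hM
    exact not_top_lt hM
  rw [hgM, Nat.cast_lt] at hM
  simp only [hgM, Nat.cast_lt]
  obtain ⟨u, hu⟩ := exists_subsingleton_of_cxSup_lt_top hP.bounded_above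
  obtain ⟨l, hl⟩ := exists_subsingleton_of_bot_lt_cxInf hP.bounded_below
  obtain ⟨a, ⟨i₀, hi₀⟩, ha⟩ := hP.homology_eq
  have hnon (i : ℤ) : Nontrivial (P.homology i) ↔ a i ≠ 0 := by
    rw [(ha i).some.nontrivial_congr]
    refine ⟨fun h h0 ↦ ?_, fun h ↦ ?_⟩
    · have : IsEmpty (Fin (a i)) := by rw [h0]; infer_instance
      exact not_subsingleton (Fin (a i) → N) inferInstance
    · have : NeZero (a i) := ⟨h⟩
      infer_instance
  have hau (i : ℤ) (hi : a i ≠ 0) : i ≤ u := by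
    by_contra! h
    have := hu i h
    exact not_nontrivial_iff_subsingleton.2 (subsingleton_homology (P := P) i) ((hnon i).2 hi)
  have hal (i : ℤ) (hi : a i ≠ 0) : l ≤ i := by
    by_contra! h
    have := hl i h
    exact not_nontrivial_iff_subsingleton.2 (subsingleton_homology (P := P) i) ((hnon i).2 hi)
  obtain ⟨s, hs, hsmax⟩ := Int.exists_greatest_of_bdd (P := fun i ↦ a i ≠ 0) ⟨u, hau⟩ ⟨i₀, hi₀⟩
  obtain ⟨t, ht, htmin⟩ := Int.exists_least_of_bdd (P := fun i ↦ a i ≠ 0) ⟨l, hal⟩ ⟨i₀, hi₀⟩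
  have hts : t ≤ s := htmin s hs
  obtain ⟨w, hw⟩ := Int.le.dest hts
  have hgt (i : ℤ) (hi : s < i) : a i = 0 := by
    by_contra h
    exact (hsmax i h).not_gt hi
  have hlt (i : ℤ) (hi : i < t) : a i = 0 := by
    by_contra h
    exact (htmin i h).not_gt hi
  have hsup_eq : hsup P = ((s : ℝ) : EReal) :=
    sSup_intCast_eq ((hnon s).2 hs) fun i hi ↦ hsmax i ((hnon i).1 hi)
  have hinf_eq : hinf P = ((t : ℝ) : EReal) :=
    sInf_intCast_eq ((hnon t).2 ht) fun i hi ↦ htmin i ((hnon i).1 hi)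
  have hwin (i : ℕ) (hi : i ≤ n + w) : (i : EReal) ≤ (n : EReal) + (hsup P - hinf P) := by
    rw [hsup_eq, hinf_eq, ← EReal.coe_sub, ← EReal.coe_coe_eq_natCast, ← EReal.coe_coe_eq_natCast,
      ← EReal.coe_add, EReal.coe_le_coe_iff, ← hw]
    push_cast
    have : (i : ℝ) ≤ n + w := by exact_mod_cast hi
    linarith
  have hproj (i : ℤ) : Module.Projective R (P.X i) := hP.projective i
  constructor
  · intro hTor i hi
    -- Dualizing reverses arrows, so degrees are negated to keep a chain complex: its cycles are
    -- `(P₋ᵢ / im)⁺` and its homology lies in degrees `-s, …, -t`.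
    have hZC (i j : ℤ) (hij : j + 1 = i) := (hasSES_chainComplex_boundaries P (-i) (-j) (-j - 1)
      (by omega) (by omega)).characterModule
    have hBZ (i : ℤ) := (hasSES_chainComplex_homology' P (-i)).characterModule
    have hC (i : ℤ) : IsTRAcyclic R (CharacterModule (P.X (-i))) :=
      -- Projective modules are flat, so their character modules are injective.
      have := Module.Flat.iff_characterModule_injective.1
        (inferInstance : Module.Flat R (P.X (-i)))
      isTRAcyclic_of_injective
    have hX (i : ℤ) (h : Subsingleton (P.X (-i))) : Subsingleton (CharacterModule (P.X (-i))) :=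
      ⟨fun φ ψ ↦ by ext x; rw [Subsingleton.elim x 0, map_zero, map_zero]⟩
    have hH (i : ℤ) : Nonempty (CharacterModule (P.homology (-i)) ≃ₗ[R]
        (Fin (a (-i)) → CharacterModule N)) :=
      ⟨(CharacterModule.congr (ha (-i)).some).trans (characterModulePiEquiv R _ N)⟩
    have hst : -s + (w : ℤ) = -t := by omega
    have key := extVanishes_of_window
      (Z := fun i ↦ ModuleCat.of R (CharacterModule
        (P.X (-i) ⧸ LinearMap.range (P.d (-i + 1) (-i)).hom)))
      (B := fun i ↦ ModuleCat.of R (CharacterModule (LinearMap.range (P.d (-i) (-i - 1)).hom)))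
      (C := fun i ↦ ModuleCat.of R (CharacterModule (P.X (-i))))
      (H := fun i ↦ ModuleCat.of R (CharacterModule (P.homology (-i))))
      (M := M) (a := fun i ↦ a (-i)) (t := -s) hZC hBZ hC hH hg (l := -u) (u := -l)
      (fun i hi ↦ hX i (hu _ (by omega))) (fun i hi ↦ hX i (hl _ (by omega)))
      (fun i hi ↦ hgt _ (by omega)) (fun i hi ↦ hlt _ (by omega))
      (by simpa using hs) (by simpa [hst] using ht) hM
      (fun j h1 h2 ↦ (torVanishes_iff_extVanishes M N j (by omega)).1 (hTor j h1 (hwin j h2))) i hi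
    exact (torVanishes_iff_extVanishes M N i (by omega)).2 key
  · intro hExt i hi
    have hZC := hasSES_chainComplex_cycles P
    have hBZ := hasSES_chainComplex_homology P
    have hC (i : ℤ) : IsTRAcyclic R (P.X i) := isTRAcyclic_of_projective
    exact extVanishes_of_window
      (Z := fun i ↦ ModuleCat.of R (LinearMap.ker (P.d i (i - 1)).hom))
      (B := fun i ↦ ModuleCat.of R (LinearMap.range (P.d (i + 1) i).hom))
      (C := P.X) (H := fun i ↦ P.homology i) hZC hBZ hC ha hg hl hu hlt (by rwa [hw]) ht
      (by rwa [hw]) hM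
      (fun j h1 h2 ↦ hExt j h1 (hwin j h2)) i hi
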